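/- Let $N\ge 0$ be an integer. The Aztec diamond of order $N$ is the union of all unit lattice squares $[i,i+1]\times[j,j+1]$, $i,j\in\mathbb{Z}$, that lie within the region $\{(x,y)\in\mathbb{R}^2: |x|+|y|\le N+1\}$. A domino is the union of two lattice squares that share an edge (placed horizontally or vertically), and a domino tiling of the Aztec diamond is a set of dominoes with pairwise no lattice square in common that together cover exactly the lattice squares of the Aztec diamond. Let $A_N$ be the number of domino tilings of the Aztec diamond of order $N$. Then $A_N$ is finite and $$A_N = 2^{N(N+1)/2}.$$ -/

import Mathlib

namespace AztecDiamond

/-- The closed unit lattice square `[i, i+1] × [j, j+1]` of the plane; a lattice square is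
referred to by its lower left corner `(i, j) ∈ ℤ²`. -/
def latticeSquare (c : ℤ × ℤ) : Set (ℝ × ℝ) :=
  Set.Icc (c.1 : ℝ) (c.1 + 1) ×ˢ Set.Icc (c.2 : ℝ) (c.2 + 1)

/-- The diamond shaped region `|x| + |y| ≤ N + 1`. -/
def diamondRegion (N : ℕ) : Set (ℝ × ℝ) :=
  {p | |p.1| + |p.2| ≤ (N : ℝ) + 1}

/-- The Aztec diamond of order `N`, as the set of the lattice squares that lie within the
diamond shaped region `|x| + |y| ≤ N + 1`. -/
def aztecDiamond (N : ℕ) : Set (ℤ × ℤ) :=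
  {c | latticeSquare c ⊆ diamondRegion N}

/-- A domino is a pair of lattice squares sharing an edge, placed horizontally or vertically. -/
def IsDomino (d : Set (ℤ × ℤ)) : Prop :=
  ∃ i j : ℤ, d = {(i, j), (i + 1, j)} ∨ d = {(i, j), (i, j + 1)}

/-- A domino tiling of a set `R` of lattice squares is a set of pairwise disjoint dominoes
whose union is `R`. -/
def IsDominoTiling (R : Set (ℤ × ℤ)) (T : Set (Set (ℤ × ℤ))) : Prop :=
  (∀ d ∈ T, IsDomino d) ∧ T.PairwiseDisjoint id ∧ ⋃₀ T = R

/-- The number `A_N` of domino tilings of the Aztec diamond of order `N`. -/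
noncomputable def tilingCount (N : ℕ) : ℕ :=
  {T : Set (Set (ℤ × ℤ)) | IsDominoTiling (aztecDiamond N) T}.ncard

end AztecDiamond

/-!
The proof shows `A_{n+1} = 2^{n+1} A_n`; it is the argument with pairs of compatible alternating
sign matrices, phrased without the matrices.

Let `V n` be the set of the lattice points `v = (x, y)` with `|x| + |y| ≤ n` and
`x + y ≡ n (mod 2)`. Around `v` there are four lattice squares, forming a `2 × 2` block. Every
domino lies in exactly one block whose centre has a prescribed parity, and for dominoes inside the
Aztec diamond of order `n`, and also for those inside the one of order `n + 1`, the centre with the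
parity of `n` belongs to `V n`. Hence a tiling of either diamond is the same as a partition of its
squares into sets `m v`, each contained in the block of `v ∈ V n`, together with a tiling of each
`m v` by dominoes of that block. So the number of tilings is the sum over such partitions of the
product of the local counts `w (m v)`, where `w` is `1` on the empty set and on pairs of adjacent
squares, `2` on the full block and `0` otherwise (`tilings_finite_and_ncard`).

A square of the diamond of order `n` lies in two blocks, a further square of the diamond of order
`n + 1` in one, and all other squares in none (`card_incidence`). Therefore taking the complement in
every block is a bijection between the partitions for order `n` and those for order `n + 1`. It
changes the weight by a constant factor: `w(sᶜ)² 2^|s| = 4 w(s)²` for each local set `s`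
(`card_localTilings_compl`), and the sizes `|m v|` add up to the number `2n(n+1)` of squares, while
`V n` has `(n+1)²` elements. The quotient of the weights is thus `2^((n+1)² - n(n+1)) = 2^(n+1)`.
-/

namespace AztecDiamond

open Finset

/-! ### Blocks and local tilings -/

/-- The four lattice squares around the lattice point `v`, numbered in cyclic order, so that
`cell v k` and `cell v (k + 1)` share an edge. -/
def cell (v : ℤ × ℤ) (k : Fin 4) : ℤ × ℤ :=
  ![(v.1, v.2), (v.1 - 1, v.2), (v.1 - 1, v.2 - 1), (v.1, v.2 - 1)] k

/-- The domino formed by the squares number `e` and `e + 1` around `v`. -/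
def blockDomino (v : ℤ × ℤ) (e : Fin 4) : Set (ℤ × ℤ) :=
  {cell v e, cell v (e + 1)}

/-- The tilings of a set `s` of squares of a block by dominoes of that block: a set `q` of dominoes,
where `e` stands for the domino on the squares `e` and `e + 1`, covers the square `k` by the
dominoes `k` and `k - 1`. -/
def localTilings (s : Finset (Fin 4)) : Finset (Finset (Fin 4)) :=
  {q | ∀ k, (if k ∈ q then 1 else 0) + (if k - 1 ∈ q then 1 else 0) = if k ∈ s then 1 else 0}

/-- Complementing `s` multiplies the number of local tilings by `2 ^ (1 - |s| / 2)`. The squared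
form avoids halving `|s|` and holds also for the sets `s` without tilings. -/
theorem card_localTilings_compl (s : Finset (Fin 4)) :
    #(localTilings sᶜ) ^ 2 * 2 ^ #s = 4 * #(localTilings s) ^ 2 := by
  revert s
  decide +kernel

theorem eq_of_mem_localTilings {s t q : Finset (Fin 4)} (hs : q ∈ localTilings s)
    (ht : q ∈ localTilings t) : s = t := by
  simp only [localTilings, mem_filter, mem_univ, true_and] at hs ht
  ext k
  have := (hs k).symm.trans (ht k)
  by_cases h₁ : k ∈ s <;> by_cases h₂ : k ∈ t <;> simp_all

theorem isDomino_blockDomino (v : ℤ × ℤ) (e : Fin 4) : IsDomino (blockDomino v e) := by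
  obtain ⟨x, y⟩ := v
  fin_cases e
  · exact ⟨x - 1, y, Or.inl (by simp [blockDomino, cell, Set.pair_comm])⟩
  · exact ⟨x - 1, y - 1, Or.inr (by simp [blockDomino, cell, Set.pair_comm])⟩
  · exact ⟨x - 1, y - 1, Or.inl (by simp [blockDomino, cell])⟩
  · exact ⟨x, y - 1, Or.inr (by simp [blockDomino, cell])⟩

theorem cell_injective (v : ℤ × ℤ) : Function.Injective (cell v) := by
  obtain ⟨x, y⟩ := v
  intro k l h
  fin_cases k <;> fin_cases l <;> simp [cell] at h ⊢ <;> omega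

/-- A domino lies in two blocks, whose centres have different parities. -/
theorem blockDomino_inj {v w : ℤ × ℤ} {e f : Fin 4} (hp : (v.1 + v.2) % 2 = (w.1 + w.2) % 2)
    (h : blockDomino v e = blockDomino w f) : v = w ∧ e = f := by
  obtain ⟨x, y⟩ := v
  obtain ⟨z, t⟩ := w
  rw [blockDomino, blockDomino, Set.pair_eq_pair_iff] at h
  fin_cases e <;> fin_cases f <;> simp [cell] at h hp ⊢ <;> omega

theorem mem_blockDomino {v : ℤ × ℤ} {e : Fin 4} {c : ℤ × ℤ} :
    c ∈ blockDomino v e ↔ cell v e = c ∨ cell v (e + 1) = c := by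
  simp [blockDomino, eq_comm]

/-! ### Tilings as families of local tilings -/

/-- The number of ways in which the square `c` is assigned to a block by `m`, which assigns to
the centre `v` the set `m v` of squares around `v`. -/
def multiplicity {V : Finset (ℤ × ℤ)} (m : V → Finset (Fin 4)) (c : ℤ × ℤ) : ℕ :=
  #{a : V × Fin 4 | a.2 ∈ m a.1 ∧ cell a.1 a.2 = c}

/-- The number of dominoes of the family `q` that cover the square `c`. -/
noncomputable def coverage {V : Finset (ℤ × ℤ)} (q : V → Finset (Fin 4)) (c : ℤ × ℤ) : ℕ := by
  classical exact #{a : V × Fin 4 | a.2 ∈ q a.1 ∧ c ∈ blockDomino a.1 a.2}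

/-- The partitions of `R` into sets of squares of the blocks with centres in `V`. -/
noncomputable def blockPartitions (V R : Finset (ℤ × ℤ)) : Finset (V → Finset (Fin 4)) := by
  classical exact {m | ∀ c, multiplicity m c = if c ∈ R then 1 else 0}

theorem mem_blockPartitions {V R : Finset (ℤ × ℤ)} {m : V → Finset (Fin 4)} :
    m ∈ blockPartitions V R ↔ ∀ c, multiplicity m c = if c ∈ R then 1 else 0 := by
  simp [blockPartitions]

/-- The set of dominoes described by the family `q`. -/
def dominoes {V : Finset (ℤ × ℤ)} (q : V → Finset (Fin 4)) : Set (Set (ℤ × ℤ)) :=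
  {d | ∃ v : V, ∃ e ∈ q v, d = blockDomino v e}

theorem coverage_eq_sum {V : Finset (ℤ × ℤ)} (q : V → Finset (Fin 4)) (c : ℤ × ℤ) :
    coverage q c = ∑ v : V, ∑ k : Fin 4, if cell v k = c then
      (if k ∈ q v then 1 else 0) + (if k - 1 ∈ q v then 1 else 0) else 0 := by
  classical
  rw [coverage, card_filter, Fintype.sum_prod_type]
  refine sum_congr rfl fun v _ => ?_
  have key : ∀ e : Fin 4, (if e ∈ q v ∧ c ∈ blockDomino v e then 1 else 0) =
      (if cell v e = c then (if e ∈ q v then 1 else 0) else 0) +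
      (if cell v (e + 1) = c then (if e ∈ q v then 1 else 0) else 0) := by
    intro e
    have hne : ¬ (cell v e = c ∧ cell v (e + 1) = c) := by
      rintro ⟨h₁, h₂⟩
      have := cell_injective v (h₁.trans h₂.symm)
      simp at this
    rw [mem_blockDomino]
    by_cases h₁ : cell v e = c <;> by_cases h₂ : cell v (e + 1) = c <;> simp_all
  have shift : ∑ e : Fin 4, (if cell v (e + 1) = c then (if e ∈ q v then 1 else 0) else 0) =
      ∑ k : Fin 4, (if cell v k = c then (if k - 1 ∈ q v then 1 else 0) else 0) :=
    Fintype.sum_equiv (Equiv.addRight 1) _ _ fun e => by simp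
  rw [sum_congr rfl fun e _ => key e, sum_add_distrib, shift, ← sum_add_distrib]
  refine sum_congr rfl fun k _ => ?_
  split_ifs <;> rfl

theorem coverage_eq_multiplicity {V : Finset (ℤ × ℤ)} {q m : V → Finset (Fin 4)}
    (h : ∀ v, q v ∈ localTilings (m v)) (c : ℤ × ℤ) : coverage q c = multiplicity m c := by
  rw [coverage_eq_sum, multiplicity, card_filter, Fintype.sum_prod_type]
  refine sum_congr rfl fun v _ => sum_congr rfl fun k _ => ?_
  have := h v
  simp only [localTilings, mem_filter, mem_univ, true_and] at this
  rw [this k]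
  by_cases h₁ : cell v k = c <;> by_cases h₂ : k ∈ m v <;> simp [h₁, h₂]

/-- A family of dominoes covering each square at most once tiles, in each block, the set of the
squares that it covers there. -/
theorem exists_localTilings {V : Finset (ℤ × ℤ)} {q : V → Finset (Fin 4)}
    (h : ∀ c, coverage q c ≤ 1) : ∃ m : V → Finset (Fin 4), ∀ v, q v ∈ localTilings (m v) := by
  refine ⟨fun v => {k | k ∈ q v ∨ k - 1 ∈ q v}, fun v => ?_⟩
  simp only [localTilings, mem_filter, mem_univ, true_and]
  intro k
  have hk := h (cell v k)
  rw [coverage_eq_sum] at hk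
  have h₁ := single_le_sum (f := fun w : V => ∑ l : Fin 4, if cell w l = cell v k then
      (if l ∈ q w then 1 else 0) + (if l - 1 ∈ q w then 1 else 0) else 0)
    (fun _ _ => Nat.zero_le _) (mem_univ v)
  have h₂ := single_le_sum (f := fun l : Fin 4 => if cell v l = cell v k then
      (if l ∈ q v then 1 else 0) + (if l - 1 ∈ q v then 1 else 0) else 0)
    (fun _ _ => Nat.zero_le _) (mem_univ k)
  have h₃ := (h₂.trans h₁).trans hk
  by_cases ha : k ∈ q v <;> by_cases hb : k - 1 ∈ q v <;> simp [ha, hb] at h₃ ⊢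

theorem exists_mem_blockPartitions_iff {V R : Finset (ℤ × ℤ)} {q : V → Finset (Fin 4)} :
    (∃ m ∈ blockPartitions V R, ∀ v, q v ∈ localTilings (m v)) ↔
      ∀ c, coverage q c = if c ∈ R then 1 else 0 := by
  constructor
  · rintro ⟨m, hm, hq⟩ c
    rw [coverage_eq_multiplicity hq, mem_blockPartitions.1 hm c]
  · intro h
    obtain ⟨m, hm⟩ := exists_localTilings (q := q) fun c => by rw [h c]; split_ifs <;> simp
    exact ⟨m, mem_blockPartitions.2 fun c => by rw [← coverage_eq_multiplicity hm, h c], hm⟩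

theorem isDominoTiling_dominoes_iff {V R : Finset (ℤ × ℤ)}
    (hV : ∀ v ∈ V, ∀ w ∈ V, (v.1 + v.2) % 2 = (w.1 + w.2) % 2) (q : V → Finset (Fin 4)) :
    IsDominoTiling R (dominoes q) ↔ ∀ c, coverage q c = if c ∈ R then 1 else 0 := by
  classical
  constructor
  · rintro ⟨-, hd, hU⟩ c
    have hcR : c ∈ R ↔ ∃ d ∈ dominoes q, c ∈ d := by
      rw [← mem_coe, ← hU, Set.mem_sUnion]
    split_ifs with hc
    · obtain ⟨_, ⟨v, e, he, rfl⟩, hce⟩ := hcR.1 hc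
      rw [coverage, card_eq_one]
      refine ⟨(v, e), ?_⟩
      ext ⟨w, f⟩
      simp only [mem_filter, mem_univ, true_and, mem_singleton, Prod.mk.injEq]
      constructor
      · rintro ⟨hf, hcf⟩
        have := hd.elim (i := blockDomino w f) (j := blockDomino v e) ⟨w, f, hf, rfl⟩
          ⟨v, e, he, rfl⟩ (Set.not_disjoint_iff.2 ⟨c, hcf, hce⟩)
        have := blockDomino_inj (hV _ w.2 _ v.2) this
        exact ⟨Subtype.ext this.1, this.2⟩
      · rintro ⟨rfl, rfl⟩
        exact ⟨he, hce⟩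
    · rw [coverage, card_eq_zero, filter_eq_empty_iff]
      exact fun a _ ha => hc (hcR.2 ⟨_, ⟨a.1, a.2, ha.1, rfl⟩, ha.2⟩)
  · intro h
    refine ⟨?_, ?_, ?_⟩
    · rintro _ ⟨v, e, -, rfl⟩
      exact isDomino_blockDomino _ _
    · rintro _ ⟨v, e, he, rfl⟩ _ ⟨w, f, hf, rfl⟩ hne
      refine Set.disjoint_left.2 fun c hc₁ hc₂ => hne ?_
      have hle : coverage q c ≤ 1 := by rw [h c]; split_ifs <;> simp
      have := card_le_one.1 hle (v, e) (by simpa using ⟨he, hc₁⟩) (w, f) (by simpa using ⟨hf, hc₂⟩)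
      rw [Prod.mk.injEq] at this
      rw [this.1, this.2]
    · ext c
      rw [mem_coe, Set.mem_sUnion]
      have hpos : c ∈ R ↔ 0 < coverage q c := by rw [h c]; split_ifs with hc <;> simp [hc]
      rw [hpos, coverage, card_pos]
      constructor
      · rintro ⟨_, ⟨v, e, he, rfl⟩, hc⟩
        exact ⟨(v, e), by simpa using ⟨he, hc⟩⟩
      · rintro ⟨a, ha⟩
        simp only [mem_filter, mem_univ, true_and] at ha
        exact ⟨_, ⟨a.1, a.2, ha.1, rfl⟩, ha.2⟩

theorem dominoes_injective {V : Finset (ℤ × ℤ)}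
    (hV : ∀ v ∈ V, ∀ w ∈ V, (v.1 + v.2) % 2 = (w.1 + w.2) % 2) :
    Function.Injective (dominoes (V := V)) := by
  have key : ∀ (q : V → Finset (Fin 4)) (v : V) (e : Fin 4),
      e ∈ q v ↔ blockDomino v e ∈ dominoes q := by
    intro q v e
    refine ⟨fun h => ⟨v, e, h, rfl⟩, ?_⟩
    rintro ⟨w, f, hf, heq⟩
    obtain ⟨h₁, rfl⟩ := blockDomino_inj (hV _ v.2 _ w.2) heq
    rwa [Subtype.ext h₁]
  intro q r h
  ext v e
  rw [key, key, h]

/-- The tilings of `R` are counted by the partitions of `R` into parts of blocks, each part being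
tiled on its own, as soon as every domino in `R` lies in a block with centre in `V`. -/
theorem tilings_finite_and_ncard {V R : Finset (ℤ × ℤ)}
    (hV : ∀ v ∈ V, ∀ w ∈ V, (v.1 + v.2) % 2 = (w.1 + w.2) % 2)
    (hR : ∀ d, IsDomino d → d ⊆ R → ∃ v ∈ V, ∃ e, d = blockDomino v e) :
    {T | IsDominoTiling R T}.Finite ∧
      {T | IsDominoTiling R T}.ncard =
        ∑ m ∈ blockPartitions V R, ∏ v, #(localTilings (m v)) := by
  classical
  set Q : Finset (V → Finset (Fin 4)) := (blockPartitions V R).biUnion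
    fun m => Fintype.piFinset fun v => localTilings (m v) with hQ
  have memQ : ∀ q, q ∈ Q ↔ IsDominoTiling R (dominoes q) := by
    intro q
    rw [isDominoTiling_dominoes_iff hV, ← exists_mem_blockPartitions_iff]
    simp [hQ]
  have himage : {T | IsDominoTiling R T} = dominoes '' (Q : Set (V → Finset (Fin 4))) := by
    ext T
    constructor
    · intro hT
      have hT' : dominoes (fun v : V => {e | blockDomino v e ∈ T}) = T := by
        ext d
        constructor
        · rintro ⟨v, e, he, rfl⟩
          simpa using he
        · intro hd
          obtain ⟨v, hv, e, rfl⟩ := hR d (hT.1 d hd) (by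
            rw [← hT.2.2]
            exact Set.subset_sUnion_of_mem hd)
          exact ⟨⟨v, hv⟩, e, by simpa using hd, rfl⟩
      refine ⟨_, ?_, hT'⟩
      rw [mem_coe, memQ, hT']
      exact hT
    · rintro ⟨q, hq, rfl⟩
      exact (memQ q).1 hq
  rw [himage]
  refine ⟨Q.finite_toSet.image _, ?_⟩
  rw [Set.ncard_image_of_injective _ (dominoes_injective hV), Set.ncard_coe_finset, hQ,
    card_biUnion]
  · exact sum_congr rfl fun m _ => Fintype.card_piFinset _
  · intro m _ m' _ hne
    refine disjoint_left.2 fun q h₁ h₂ => hne ?_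
    rw [Fintype.mem_piFinset] at h₁ h₂
    exact funext fun v => eq_of_mem_localTilings (h₁ v) (h₂ v)

theorem sum_card_of_mem_blockPartitions {V R : Finset (ℤ × ℤ)} {m : V → Finset (Fin 4)}
    (hm : m ∈ blockPartitions V R) : ∑ v, #(m v) = #R := by
  classical
  rw [mem_blockPartitions] at hm
  have h₁ : ∑ v, #(m v) = #{a : V × Fin 4 | a.2 ∈ m a.1} := by
    rw [card_filter, Fintype.sum_prod_type]
    exact sum_congr rfl fun v _ => by simp
  rw [h₁, card_eq_sum_card_fiberwise (f := fun a : V × Fin 4 => cell a.1 a.2) (t := R)]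
  · rw [card_eq_sum_ones]
    refine sum_congr rfl fun c hc => ?_
    have := hm c
    rw [if_pos hc] at this
    rw [filter_filter]
    exact this
  · intro a ha
    by_contra hc
    replace hc : cell a.1 a.2 ∉ R := hc
    have h := hm (cell a.1 a.2)
    rw [if_neg hc, multiplicity, card_eq_zero, filter_eq_empty_iff] at h
    exact h (mem_univ a) ⟨by simpa using ha, rfl⟩

/-! ### The geometry of the Aztec diamond -/

/-- The Aztec diamond of order `n` as a finite set: the square with lower left corner `(i, j)` has
its centre at `(i + 1/2, j + 1/2)`. -/
noncomputable def squares (n : ℕ) : Finset (ℤ × ℤ) :=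
  {c ∈ Icc (-n : ℤ) n ×ˢ Icc (-n : ℤ) n | |2 * c.1 + 1| + |2 * c.2 + 1| ≤ 2 * n}

/-- The lattice points `(x, y)` with `|x| + |y| ≤ n` and `x + y` of the parity of `n`. -/
noncomputable def centres (n : ℕ) : Finset (ℤ × ℤ) :=
  {v ∈ Icc (-n : ℤ) n ×ˢ Icc (-n : ℤ) n | |v.1| + |v.2| ≤ n ∧ (v.1 + v.2) % 2 = n % 2}

theorem mem_squares {n : ℕ} {c : ℤ × ℤ} :
    c ∈ squares n ↔ |2 * c.1 + 1| + |2 * c.2 + 1| ≤ 2 * n := by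
  simp only [squares, mem_filter, mem_product, mem_Icc, and_iff_right_iff_imp]
  grind

theorem mem_centres {n : ℕ} {v : ℤ × ℤ} :
    v ∈ centres n ↔ |v.1| + |v.2| ≤ n ∧ (v.1 + v.2) % 2 = n % 2 := by
  simp only [centres, mem_filter, mem_product, mem_Icc, and_iff_right_iff_imp]
  grind

theorem coe_squares (n : ℕ) : (squares n : Set (ℤ × ℤ)) = aztecDiamond n := by
  ext ⟨i, j⟩
  rw [mem_coe, mem_squares]
  constructor
  · rintro h ⟨x, y⟩ ⟨⟨hx₁, hx₂⟩, ⟨hy₁, hy₂⟩⟩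
    have h' : |2 * (i : ℝ) + 1| + |2 * (j : ℝ) + 1| ≤ 2 * n := by exact_mod_cast h
    simp only [diamondRegion, Set.mem_ofPred_eq] at hx₁ hx₂ hy₁ hy₂ ⊢
    grind
  · intro h
    -- The corner of a square that is farthest from the origin in each coordinate.
    have far : ∀ a : ℤ, ∃ b : ℤ, a ≤ b ∧ b ≤ a + 1 ∧ |2 * a + 1| + 1 = 2 * |b| := by
      intro a
      rcases le_or_gt 0 a with ha | ha
      · exact ⟨a + 1, by omega, le_rfl, by grind⟩
      · exact ⟨a, le_rfl, by omega, by grind⟩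
    obtain ⟨x, hx₁, hx₂, hx⟩ := far i
    obtain ⟨y, hy₁, hy₂, hy⟩ := far j
    have hxy : ((x : ℝ), (y : ℝ)) ∈ diamondRegion n := by
      refine h ⟨⟨?_, ?_⟩, ⟨?_, ?_⟩⟩ <;> dsimp only <;> assumption_mod_cast
    have hxy' : |x| + |y| ≤ (n : ℤ) + 1 := by
      simp only [diamondRegion, Set.mem_ofPred_eq] at hxy
      exact_mod_cast hxy
    dsimp only
    omega

theorem centres_parity (n : ℕ) :
    ∀ v ∈ centres n, ∀ w ∈ centres n, (v.1 + v.2) % 2 = (w.1 + w.2) % 2 :=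
  fun _ hv _ hw => (mem_centres.1 hv).2.trans (mem_centres.1 hw).2.symm

theorem squares_subset_succ (n : ℕ) : squares n ⊆ squares (n + 1) := by
  intro c hc
  rw [mem_squares] at hc ⊢
  push_cast
  omega

/-- A lattice point of the parity of `n` outside `centres n` lies in at most one square of the
Aztec diamond of order `n + 1`, so it is not the centre of a block containing a domino. -/
theorem exists_blockDomino_of_subset_succ {n : ℕ} (d : Set (ℤ × ℤ)) (hd : IsDomino d)
    (hsub : d ⊆ squares (n + 1)) : ∃ v ∈ centres n, ∃ e, d = blockDomino v e := by
  obtain ⟨i, j, rfl | rfl⟩ := hd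
  · have h₁ := mem_squares.1 (mem_coe.1 (hsub (Set.mem_insert _ _)))
    have h₂ := mem_squares.1 (mem_coe.1 (hsub (Set.mem_insert_of_mem _ rfl)))
    push_cast at h₁ h₂
    rcases Int.emod_two_eq_zero_or_one (i + j + 1 + n) with hp | hp
    · refine ⟨(i + 1, j), mem_centres.2 ⟨?_, ?_⟩, 0, by simp [blockDomino, cell, Set.pair_comm]⟩
      · grind
      · dsimp only
        omega
    · refine ⟨(i + 1, j + 1), mem_centres.2 ⟨?_, ?_⟩, 2, by simp [blockDomino, cell]⟩
      · grind
      · dsimp only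
        omega
  · have h₁ := mem_squares.1 (mem_coe.1 (hsub (Set.mem_insert _ _)))
    have h₂ := mem_squares.1 (mem_coe.1 (hsub (Set.mem_insert_of_mem _ rfl)))
    push_cast at h₁ h₂
    rcases Int.emod_two_eq_zero_or_one (i + j + 1 + n) with hp | hp
    · refine ⟨(i, j + 1), mem_centres.2 ⟨?_, ?_⟩, 3, by simp [blockDomino, cell]⟩
      · grind
      · dsimp only
        omega
    · refine ⟨(i + 1, j + 1), mem_centres.2 ⟨?_, ?_⟩, 1,
        by simp [blockDomino, cell, Set.pair_comm]⟩
      · grind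
      · dsimp only
        omega

/-- The squares of the Aztec diamond of order `n` lie in two blocks with centre in `centres n`,
those added in order `n + 1` lie in one, and the others in none. -/
theorem card_incidence (n : ℕ) (c : ℤ × ℤ) :
    #{a : centres n × Fin 4 | cell a.1 a.2 = c} =
      (if c ∈ squares n then 1 else 0) + (if c ∈ squares (n + 1) then 1 else 0) := by
  have h₁ : #{a : centres n × Fin 4 | cell a.1 a.2 = c} =
      ∑ k : Fin 4, ∑ v ∈ centres n, if cell v k = c then 1 else 0 := by
    rw [card_filter, Fintype.sum_prod_type_right]
    exact sum_congr rfl fun k _ => sum_coe_sort (centres n) fun v => if cell v k = c then 1 else 0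
  obtain ⟨i, j⟩ := c
  have h₂ : ∀ (k : Fin 4) (w : ℤ × ℤ), (∀ v, cell v k = (i, j) ↔ v = w) →
      (∑ v ∈ centres n, if cell v k = (i, j) then 1 else 0) =
        if w ∈ centres n then 1 else 0 := by
    intro k w h
    simp [h]
  rw [h₁, Fin.sum_univ_four,
    h₂ 0 (i, j) (by rintro ⟨x, y⟩; simp [cell]),
    h₂ 1 (i + 1, j) (by rintro ⟨x, y⟩; simp [cell]; omega),
    h₂ 2 (i + 1, j + 1) (by rintro ⟨x, y⟩; simp [cell]; omega),
    h₂ 3 (i, j + 1) (by rintro ⟨x, y⟩; simp [cell]; omega)]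
  simp only [mem_centres, mem_squares]
  push_cast
  rcases Int.emod_two_eq_zero_or_one (i + j + n) with hp | hp
  · have e₁ : (i + 1 + j) % 2 ≠ n % 2 := by omega
    have e₂ : (i + (j + 1)) % 2 ≠ n % 2 := by omega
    have e₃ : (i + j) % 2 = n % 2 := by omega
    have e₄ : (i + 1 + (j + 1)) % 2 = n % 2 := by omega
    simp only [e₁, e₂, e₃, e₄, and_false, and_true, if_false]
    grind
  · have e₁ : (i + 1 + j) % 2 = n % 2 := by omega
    have e₂ : (i + (j + 1)) % 2 = n % 2 := by omega
    have e₃ : (i + j) % 2 ≠ n % 2 := by omega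
    have e₄ : (i + 1 + (j + 1)) % 2 ≠ n % 2 := by omega
    simp only [e₁, e₂, e₃, e₄, and_false, and_true, if_false]
    grind

theorem card_centres (n : ℕ) : #(centres n) = (n + 1) ^ 2 := by
  have : #(range (n + 1) ×ˢ range (n + 1)) = #(centres n) := by
    -- The coordinates `x + y` and `x - y` run independently through `-n, -n + 2, …, n`.
    refine card_nbij' (fun a => ((a.1 : ℤ) - a.2, (a.1 : ℤ) + a.2 - n))
      (fun v => (((v.1 + v.2 + n) / 2).toNat, ((v.2 - v.1 + n) / 2).toNat)) ?_ ?_ ?_ ?_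
    · rintro ⟨a, b⟩ h
      simp only [coe_product, coe_range, Set.mem_prod, Set.mem_Iio] at h
      refine mem_centres.2 ⟨?_, ?_⟩
      · grind
      · dsimp only
        omega
    · rintro ⟨x, y⟩ h
      obtain ⟨h₁, h₂⟩ := mem_centres.1 h
      simp only [coe_product, coe_range, Set.mem_prod, Set.mem_Iio]
      grind
    · rintro ⟨a, b⟩ h
      simp only [Prod.mk.injEq]
      omega
    · rintro ⟨x, y⟩ h
      obtain ⟨h₁, h₂⟩ := mem_centres.1 h
      simp only [Prod.mk.injEq]
      dsimp only at h₁ h₂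
      rw [Int.toNat_of_nonneg (by grind), Int.toNat_of_nonneg (by grind)]
      omega
  rw [← this, card_product, card_range, sq]

theorem multiplicity_add_multiplicity_compl {n : ℕ} (m : centres n → Finset (Fin 4))
    (c : ℤ × ℤ) :
    multiplicity m c + multiplicity mᶜ c =
      (if c ∈ squares n then 1 else 0) + (if c ∈ squares (n + 1) then 1 else 0) := by
  rw [← card_incidence, multiplicity, multiplicity,
    ← card_filter_add_card_filter_not (s := {a : centres n × Fin 4 | cell a.1 a.2 = c})
      (fun a => a.2 ∈ m a.1), filter_filter, filter_filter]
  congr 2 <;> ext a <;> simp [and_comm]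

theorem compl_mem_blockPartitions_iff {n : ℕ} {m : centres n → Finset (Fin 4)} :
    mᶜ ∈ blockPartitions (centres n) (squares (n + 1)) ↔
      m ∈ blockPartitions (centres n) (squares n) := by
  rw [mem_blockPartitions, mem_blockPartitions]
  refine forall_congr' fun c => ?_
  have := multiplicity_add_multiplicity_compl m c
  omega

theorem card_squares (n : ℕ) : #(squares n) = 2 * (n * (n + 1)) := by
  induction n with
  | zero =>
    rw [card_eq_zero, eq_empty_iff_forall_notMem]
    intro c hc
    rw [mem_squares] at hc
    grind
  | succ n ih =>
    -- Count the incidences between the squares and the blocks around `centres n`.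
    have h : #(univ : Finset (centres n × Fin 4)) = #(squares n) + #(squares (n + 1)) := by
      rw [card_eq_sum_card_fiberwise (f := fun a : centres n × Fin 4 => cell a.1 a.2)
        (t := squares (n + 1))]
      · rw [sum_congr rfl fun c _ => card_incidence n c, sum_add_distrib, ← card_filter,
          ← card_filter, filter_mem_eq_inter, filter_mem_eq_inter, inter_self,
          inter_eq_right.2 (squares_subset_succ n)]
      · intro a _
        by_contra hc
        replace hc : cell a.1 a.2 ∉ squares (n + 1) := hc
        have hc' := card_incidence n (cell a.1 a.2)
        rw [if_neg hc, if_neg fun h => hc (squares_subset_succ n h), card_eq_zero,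
          filter_eq_empty_iff] at hc'
        exact hc' (mem_univ a) rfl
    rw [card_univ, Fintype.card_prod, Fintype.card_coe, card_centres, Fintype.card_fin, ih] at h
    nlinarith

/-! ### The recursion -/

theorem tilings_finite (n : ℕ) : {T | IsDominoTiling (aztecDiamond n) T}.Finite := by
  rw [← coe_squares]
  exact (tilings_finite_and_ncard (centres_parity n) fun d hd h =>
    exists_blockDomino_of_subset_succ d hd (h.trans (coe_subset.2 (squares_subset_succ n)))).1

theorem tilingCount_eq_sum (n : ℕ) : tilingCount n =
    ∑ m ∈ blockPartitions (centres n) (squares n), ∏ v, #(localTilings (m v)) := by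
  rw [tilingCount, ← coe_squares]
  exact (tilings_finite_and_ncard (centres_parity n) fun d hd h =>
    exists_blockDomino_of_subset_succ d hd (h.trans (coe_subset.2 (squares_subset_succ n)))).2

theorem tilingCount_succ_eq_sum (n : ℕ) : tilingCount (n + 1) =
    ∑ m ∈ blockPartitions (centres n) (squares n), ∏ v, #(localTilings (m v)ᶜ) := by
  rw [tilingCount, ← coe_squares, (tilings_finite_and_ncard (centres_parity n)
    exists_blockDomino_of_subset_succ).2]
  refine (sum_nbij' compl compl (fun m hm => compl_mem_blockPartitions_iff.2 hm)
    (fun m hm => ?_) (fun m _ => compl_compl m) (fun m _ => compl_compl m) fun m _ => rfl).symm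
  rw [← compl_mem_blockPartitions_iff, compl_compl]
  exact hm

/-- Complementing all parts of a block partition multiplies its weight by `2 ^ (n + 1)`. -/
theorem prod_card_localTilings_compl {n : ℕ} {m : centres n → Finset (Fin 4)}
    (hm : m ∈ blockPartitions (centres n) (squares n)) :
    ∏ v, #(localTilings (m v)ᶜ) = 2 ^ (n + 1) * ∏ v, #(localTilings (m v)) := by
  have h : ∏ v, (#(localTilings (m v)ᶜ) ^ 2 * 2 ^ #(m v)) =
      ∏ v, (4 * #(localTilings (m v)) ^ 2) :=
    prod_congr rfl fun v _ => card_localTilings_compl (m v)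
  rw [prod_mul_distrib, prod_mul_distrib, prod_pow, prod_pow, prod_pow_eq_pow_sum,
    sum_card_of_mem_blockPartitions hm, card_squares, prod_const, card_univ, Fintype.card_coe,
    card_centres] at h
  have hpow : (4 : ℕ) ^ (n + 1) ^ 2 = (2 ^ (n + 1)) ^ 2 * 2 ^ (2 * (n * (n + 1))) := by
    rw [show (4 : ℕ) = 2 ^ 2 from rfl, ← pow_mul, ← pow_mul, ← pow_add]
    congr 1
    ring
  refine Nat.pow_left_injective two_ne_zero (Nat.eq_of_mul_eq_mul_right
    (pow_pos two_pos (2 * (n * (n + 1)))) ?_)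
  dsimp only
  rw [h, hpow]
  ring

theorem tilingCount_succ (n : ℕ) : tilingCount (n + 1) = 2 ^ (n + 1) * tilingCount n := by
  rw [tilingCount_succ_eq_sum, tilingCount_eq_sum, mul_sum]
  exact sum_congr rfl fun m hm => prod_card_localTilings_compl hm

theorem tilingCount_zero : tilingCount 0 = 1 := by
  have hR : squares 0 = ∅ := card_eq_zero.1 (card_squares 0)
  have : {T | IsDominoTiling (aztecDiamond 0) T} = {∅} := by
    ext T
    rw [← coe_squares, hR, coe_empty, Set.mem_ofPred_eq, Set.mem_singleton_iff]
    constructor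
    · rintro ⟨hd, -, hU⟩
      refine Set.eq_empty_of_forall_notMem fun d hdT => ?_
      have hsub : d ⊆ ∅ := hU ▸ Set.subset_sUnion_of_mem hdT
      obtain ⟨i, j, rfl | rfl⟩ := hd d hdT <;> exact hsub (Set.mem_insert _ _)
    · rintro rfl
      exact ⟨by simp, by simp, by simp⟩
  rw [tilingCount, this, Set.ncard_singleton]

end AztecDiamond

theorem mainTheorem2 (N : ℕ) :
    {T : Set (Set (ℤ × ℤ)) |
        AztecDiamond.IsDominoTiling (AztecDiamond.aztecDiamond N) T}.Finite ∧
      AztecDiamond.tilingCount N = 2 ^ (N * (N + 1) / 2) := by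
  refine ⟨AztecDiamond.tilings_finite N, ?_⟩
  induction N with
  | zero => simpa using AztecDiamond.tilingCount_zero
  | succ n ih =>
    rw [AztecDiamond.tilingCount_succ, ih, ← pow_add]
    congr 1
    have : (n + 1) * (n + 1 + 1) = n * (n + 1) + (n + 1) * 2 := by ring
    rw [this, Nat.add_mul_div_right _ _ two_pos, add_comm]
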